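/- Let $k$ be an algebraically closed field of characteristic $p>0$, let $q=p^e$ with $e\ge 1$, and let $n\ge 1$ be an integer. For a nonzero matrix $A=(a_{ij})_{0\le i,j\le n}\in M_{n+1}(k)$ let $X_A\subset\mathbb P^n$ be the hypersurface of degree $q+1$ defined by $\sum_{i,j} a_{ij}x_ix_j^q=0$. Write $A\sim A'$ if there is $T\in GL_{n+1}(k)$ with $A'={}^tT\,A\,T^{(q)}$, where $T^{(q)}$ is obtained from $T$ by raising each entry to the $q$-th power. Let $W_{n-1}\in M_{n+1}(k)$ be the block diagonal matrix $$W_{n-1}=\begin{pmatrix} I_{n-1} & 0\\ 0 & E_2\end{pmatrix},\qquad E_2=\begin{pmatrix}0&0\\1&0\end{pmatrix},$$ and let $X_{n-1}$ be the hypersurface associated with $W_{n-1}$. Then for a general point $A$ of the locus $Z=\{A\in M_{n+1}(k)\mid \operatorname{rank}(A)=n\}$, that is, for all $A$ in some nonempty subset of $Z$ that is open and dense in $Z$ for the Zariski topology, one has $A\sim W_{n-1}$. In particular, $X_A$ is projectively isomorphic to $X_{n-1}$: some linear change of homogeneous coordinates in $GL_{n+1}(k)$ carries one hypersurface onto the other.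 -/

import Mathlib

open scoped LinearAlgebra.Projectivization

noncomputable section

namespace DegenerateFermat

variable {k : Type*} [Field k]

/-- The form `∑ a_ij x_i x_j ^ q` attached to the matrix `A = (a_ij)`. -/
def form {N : ℕ} (q : ℕ) (A : Matrix (Fin N) (Fin N) k) : MvPolynomial (Fin N) k :=
  ∑ i, ∑ j, MvPolynomial.C (A i j) * MvPolynomial.X i * MvPolynomial.X j ^ q

/-- The matrix `T^(q)`, obtained from `T` by raising each coefficient to its `q`-th power. -/
def frobeniusTwist {N : ℕ} (q : ℕ) (T : Matrix (Fin N) (Fin N) k) : Matrix (Fin N) (Fin N) k :=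
  T.map fun a => a ^ q

/-- The relation `A ∼ A'`: one has `A' = ᵗT A T^(q)` for some invertible matrix `T`. -/
def Equivalent {N : ℕ} (q : ℕ) (A A' : Matrix (Fin N) (Fin N) k) : Prop :=
  ∃ T : GL (Fin N) k,
    A' = (T : Matrix (Fin N) (Fin N) k).transpose * A *
      frobeniusTwist q (T : Matrix (Fin N) (Fin N) k)

/-- The block diagonal matrix `W_s` of size `n + 1` with blocks `I_s` and `E_(n-s+1)`, where `E_r`
is the `r × r` matrix with ones just below the diagonal and zeros elsewhere. Rows and columns are
numbered from `0` to `n`. -/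
def W (k : Type*) [Field k] (n s : ℕ) : Matrix (Fin (n + 1)) (Fin (n + 1)) k :=
  Matrix.of fun i j =>
    if (i.val < s ∧ i.val = j.val) ∨ (s ≤ j.val ∧ i.val = j.val + 1) then 1 else 0

/-- The set of points of projective space, with homogeneous coordinates indexed by `Fin N`, at which
a form `F` vanishes. -/
def hypersurface {N : ℕ} (F : MvPolynomial (Fin N) k) : Set (ℙ k (Fin N → k)) :=
  {P | ∀ v ∈ P.submodule, MvPolynomial.eval v F = 0}

/-- The linear change of coordinates `x_i ↦ ∑ t_ij x_j` on polynomials. -/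
def changeCoordinates {N : ℕ} (T : Matrix (Fin N) (Fin N) k) :
    MvPolynomial (Fin N) k →ₐ[k] MvPolynomial (Fin N) k :=
  MvPolynomial.aeval fun i => ∑ j, MvPolynomial.C (T i j) * MvPolynomial.X j

open scoped Pointwise in
/-- The hypersurfaces `F = 0` and `G = 0` are projectively isomorphic: some projective linear
transformation `[T]` carries the second onto the first, both as closed subschemes (the change of
coordinates carries the homogeneous ideal of the first to that of the second, so multiplicities are
respected) and as sets of points. -/
def ProjectivelyIsomorphic {N : ℕ} (F G : MvPolynomial (Fin N) k) : Prop :=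
  ∃ T : GL (Fin N) k,
    Ideal.map (changeCoordinates (T : Matrix (Fin N) (Fin N) k)) (Ideal.span {F}) =
        Ideal.span {G} ∧
      Matrix.GeneralLinearGroup.toLin T • hypersurface G = hypersurface F

/-- The Zariski topology on the affine space of `N × N` matrices, generated by the
nonvanishing sets of polynomials in the entries. -/
abbrev zariskiTopology (k : Type*) [Field k] (N : ℕ) :
    TopologicalSpace (Matrix (Fin N) (Fin N) k) :=
  TopologicalSpace.generateFrom
    (Set.range fun f : MvPolynomial (Fin N × Fin N) k =>
      {A | MvPolynomial.eval (fun ij => A ij.1 ij.2) f ≠ 0})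

/-- `P` holds for a general point of `Z`: it holds at all points of a nonempty subset of `Z` which
is open and dense in `Z` for the Zariski topology. -/
def HoldsAtGeneralPoint {N : ℕ} (Z : Set (Matrix (Fin N) (Fin N) k))
    (P : Matrix (Fin N) (Fin N) k → Prop) : Prop :=
  ∃ V : Set (Matrix (Fin N) (Fin N) k),
    @IsOpen _ (zariskiTopology k N) V ∧ (Z ∩ V).Nonempty ∧
      Z ⊆ @closure _ (zariskiTopology k N) (Z ∩ V) ∧ ∀ A ∈ Z ∩ V, P A

end DegenerateFermat

end

/-! Read A as the form B(x, y) = ᵗx A y^(q), linear in x and σ-semilinear in y, where σ is the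
q-Frobenius; then A ∼ A' is a change of basis. In rank n the left and right kernels are lines ⟨l⟩
and ⟨r⟩. If B(r, l) ≠ 0, then B is nondegenerate on the complement U = {x | B(x, l) = 0 = B(r, x)}
of ⟨l, r⟩, and an orthonormal basis of U followed by l and a multiple of r has Gram matrix W
(`exists_family_eq_W`).

Orthonormal bases come from a Lang-type argument. For nondegenerate B, the map φ with B(φ v, x) =
σ(B(x, v)) is injective and σ²-semilinear, so its fixed vectors, the Hermitian ones, span
(`span_fixed_eq_top`). Gram–Schmidt then works with coefficients in the fixed field of σ².

The adjugate turns B(r, l) ≠ 0 into the nonvanishing of polynomials in the entries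
(`kernelPairing`), one of which is nonzero at W. Matrices of fixed rank form an irreducible set, so
this open condition is dense (`exists_rank_eq_eval_ne_zero`). -/

namespace DegenerateFermat

/-! ### Fixed vectors of Frobenius-semilinear maps -/

section FixedVectors

open Polynomial

variable {k : Type*} [Field k]

/-- The polynomials `P₀ = a₀ X ^ Q`, `P_{i+1} = P_i ^ Q + a_{i+1} X ^ Q`: the coordinates, in terms
of the last one, of a fixed vector of a semilinear map along a cyclic basis. -/
noncomputable def cyclicPoly (Q : ℕ) (a : ℕ → k) : ℕ → k[X]
  | 0 => C (a 0) * X ^ Q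
  | i + 1 => cyclicPoly Q a i ^ Q + C (a (i + 1)) * X ^ Q

theorem X_sq_dvd_cyclicPoly {Q : ℕ} (hQ : 2 ≤ Q) (a : ℕ → k) (i : ℕ) :
    X ^ 2 ∣ cyclicPoly Q a i := by
  induction i with
  | zero => exact Dvd.dvd.mul_left (pow_dvd_pow _ hQ) _
  | succ i ih =>
    refine dvd_add (dvd_trans ih (dvd_pow_self _ (by omega))) ?_
    exact Dvd.dvd.mul_left (pow_dvd_pow _ hQ) _

/-- A nonzero P_i has degree at least 2, so P_i ^ Q has degree at least 2Q and cannot be cancelled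
by a multiple of X ^ Q. -/
theorem eq_zero_of_cyclicPoly_eq_zero {Q : ℕ} (hQ : 2 ≤ Q) (a : ℕ → k) (i : ℕ)
    (h : cyclicPoly Q a i = 0) : ∀ j ≤ i, a j = 0 := by
  induction i with
  | zero =>
    intro j hj
    obtain rfl : j = 0 := by omega
    simpa [cyclicPoly] using h
  | succ i ih =>
    have h0 : cyclicPoly Q a i = 0 := by
      by_contra hne
      have hdeg : 2 ≤ (cyclicPoly Q a i).natDegree := by
        simpa using natDegree_le_of_dvd (X_sq_dvd_cyclicPoly hQ a i) hne
      have h1 : cyclicPoly Q a i ^ Q = -(C (a (i + 1)) * X ^ Q) := eq_neg_of_add_eq_zero_left h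
      have h2 := congrArg natDegree h1
      rw [natDegree_pow, natDegree_neg] at h2
      have h3 := natDegree_C_mul_X_pow_le (a (i + 1)) Q
      nlinarith
    have h1 : a (i + 1) = 0 := by
      have h' := h
      rw [cyclicPoly, h0, zero_pow (by omega)] at h'
      simpa using h'
    intro j hj
    rcases Nat.lt_or_ge i j with hj' | hj'
    · rwa [show j = i + 1 by omega]
    · exact ih h0 j hj'

variable [IsAlgClosed k]

/-- `P - X` has a nonzero root as soon as `P` is a nonzero polynomial divisible by `X ^ 2`. -/
theorem exists_ne_zero_eval_eq_self {P : k[X]} (hP : P ≠ 0) (hX : X ^ 2 ∣ P) :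
    ∃ t : k, t ≠ 0 ∧ P.eval t = t := by
  obtain ⟨h, rfl⟩ := hX
  have hh : h ≠ 0 := right_ne_zero_of_mul hP
  -- P - X = X (X h - 1), and a root of the second factor cannot be 0.
  have hdeg : (X * h - 1 : k[X]).degree ≠ 0 := by
    have h1 : (1 : k[X]).degree < (X * h).degree := by
      rw [degree_mul, degree_X, degree_one, degree_eq_natDegree hh]
      norm_cast
      omega
    rw [degree_sub_eq_left_of_degree_lt h1]
    intro h2
    rw [h2, degree_one] at h1
    exact lt_irrefl _ h1
  obtain ⟨t, ht⟩ := IsAlgClosed.exists_root _ hdeg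
  have ht' : t * h.eval t = 1 := by
    simpa [IsRoot, sub_eq_zero] using ht
  refine ⟨t, left_ne_zero_of_mul_eq_one ht', ?_⟩
  simp only [eval_mul, eval_pow, eval_X]
  linear_combination t * ht'

theorem exists_pow_eq {Q : ℕ} (hQ : 2 ≤ Q) (c : k) : ∃ x : k, x ^ Q = c :=
  IsAlgClosed.exists_pow_nat_eq c (by omega)

theorem exists_pow_sub_self_eq {Q : ℕ} (hQ : 2 ≤ Q) (c : k) : ∃ x : k, x ^ Q - x = c := by
  have hdeg : (X ^ Q - (X + C c) : k[X]).degree ≠ 0 := by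
    have h1 : (X + C c : k[X]).degree < (X ^ Q : k[X]).degree := by
      rw [degree_X_add_C, degree_X_pow]
      exact_mod_cast hQ
    rw [degree_sub_eq_left_of_degree_lt h1, degree_X_pow]
    norm_cast
    omega
  obtain ⟨t, ht⟩ := IsAlgClosed.exists_root _ hdeg
  refine ⟨t, ?_⟩
  have ht' : t ^ Q - (t + c) = 0 := by simpa [IsRoot] using ht
  linear_combination ht'

variable {V : Type*} [AddCommGroup V] [Module k V] [FiniteDimensional k V]
  {τ : k →+* k} {Q : ℕ}

/-- An injective Frobenius-semilinear endomorphism of a nonzero finite-dimensional space has a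
nonzero fixed vector. -/
theorem exists_fixed_ne_zero [Nontrivial V] (hQ : 2 ≤ Q) (hτ : ∀ x, τ x = x ^ Q)
    (φ : V →ₛₗ[τ] V) (hφ : Function.Injective φ) : ∃ v, v ≠ 0 ∧ φ v = v := by
  obtain ⟨v, hv⟩ := exists_ne (0 : V)
  let u : ℕ → V := fun i => φ^[i] v
  have hu : ∀ i, φ (u i) = u (i + 1) := fun i => (Function.iterate_succ_apply' φ i v).symm
  have hu0 : ∀ i, u i ≠ 0 := by
    intro i
    induction i with
    | zero => exact hv
    | succ i ih =>
      rw [← hu]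
      exact fun h => ih (hφ (h.trans (map_zero φ).symm))
  classical
  have hex : ∃ r, ¬ LinearIndependent k (fun i : Fin (r + 1) => u i) := by
    refine ⟨Module.finrank k V, fun h => ?_⟩
    have := h.fintype_card_le_finrank
    simp at this
  -- With r minimal, u 0, …, u (r - 1) is a basis of the cyclic subspace generated by v.
  obtain ⟨r, hr, hmin⟩ : ∃ r, ¬ LinearIndependent k (fun i : Fin (r + 1) => u i) ∧
      LinearIndependent k (fun i : Fin r => u i) := by
    refine ⟨Nat.find hex, Nat.find_spec hex, ?_⟩
    rcases hn : Nat.find hex with _ | m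
    · exact linearIndependent_empty_type
    · have := Nat.find_min hex (m := m) (by omega)
      exact not_not.mp this
  have hmem : u r ∈ Submodule.span k (Set.range fun i : Fin r => u i) := by
    by_contra hnot
    apply hr
    have := hmin.finSnoc (x := u r) hnot
    convert this using 1
    funext i
    refine Fin.lastCases ?_ (fun j => ?_) i <;> simp
  obtain ⟨c, hc⟩ := (Submodule.mem_span_range_iff_exists_fun k).mp hmem
  have hr0 : r ≠ 0 := by
    rintro rfl
    exact hu0 0 (by simpa using hc.symm)
  obtain ⟨m, rfl⟩ := Nat.exists_eq_succ_of_ne_zero hr0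
  let a : ℕ → k := fun i => if h : i < m + 1 then c ⟨i, h⟩ else 0
  have ha : u (m + 1) = ∑ i ∈ Finset.range (m + 1), a i • u i := by
    rw [← hc, Finset.sum_range]
    refine Finset.sum_congr rfl fun i _ => ?_
    rw [show a i = c i from dif_pos i.isLt]
  have hP : cyclicPoly Q a m ≠ 0 := by
    intro h
    have h0 := eq_zero_of_cyclicPoly_eq_zero hQ a m h
    refine hu0 (m + 1) ?_
    rw [ha]
    refine Finset.sum_eq_zero fun i hi => ?_
    rw [h0 i (by simpa [Nat.lt_succ_iff] using hi), zero_smul]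
  obtain ⟨t, ht0, ht⟩ := exists_ne_zero_eval_eq_self hP (X_sq_dvd_cyclicPoly hQ a m)
  -- Comparing coefficients in φ(∑ x_i u_i) = ∑ x_i u_i gives x_0 = a_0 x_m ^ Q and x_{i+1} = x_i ^
  -- Q + a_{i+1} x_m ^ Q. With t = x_m this is x_i = P_i(t), and the system closes when P_m(t) = t.
  let x : ℕ → k := fun i => (cyclicPoly Q a i).eval t
  have hx0 : x 0 = a 0 * t ^ Q := by simp [x, cyclicPoly]
  have hx1 : ∀ i, x (i + 1) = x i ^ Q + a (i + 1) * t ^ Q := by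
    intro i
    simp [x, cyclicPoly]
  have hxm : x m = t := ht
  refine ⟨∑ i ∈ Finset.range (m + 1), x i • u i, ?_, ?_⟩
  · intro h
    have h' : ∑ i : Fin (m + 1), x i • u i = 0 := by rw [← h, Finset.sum_range]
    have := Fintype.linearIndependent_iff.mp hmin (fun i => x i) h' (Fin.last m)
    exact ht0 (hxm.symm.trans (by simpa using this))
  · have h1 : φ (∑ i ∈ Finset.range (m + 1), x i • u i) =
        ∑ i ∈ Finset.range (m + 1), x i ^ Q • u (i + 1) := by
      rw [map_sum]
      refine Finset.sum_congr rfl fun i _ => ?_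
      rw [LinearMap.map_smulₛₗ, hτ, hu]
    rw [h1, Finset.sum_range_succ, hxm, ha, Finset.smul_sum, Finset.sum_range_succ',
      Finset.sum_range_succ' (fun i => x i • u i), ← add_assoc, ← Finset.sum_add_distrib, hx0,
      smul_smul, mul_comm]
    congr 1
    refine Finset.sum_congr rfl fun i _ => ?_
    rw [hx1, smul_smul, ← add_smul, mul_comm (t ^ Q)]

/-- The fixed vectors of an injective Frobenius-semilinear endomorphism span the space. -/
theorem span_fixed_eq_top (hQ : 2 ≤ Q) (hτ : ∀ x, τ x = x ^ Q)
    (φ : V →ₛₗ[τ] V) (hφ : Function.Injective φ) :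
    Submodule.span k {v | φ v = v} = ⊤ := by
  set S := Submodule.span k {v | φ v = v} with hS
  have hstable : ∀ s ∈ S, φ s ∈ S := by
    intro s hs
    induction hs using Submodule.span_induction with
    | mem v hv => rw [show φ v = v from hv]; exact Submodule.subset_span hv
    | zero => simp
    | add v w _ _ hv hw => rw [map_add]; exact S.add_mem hv hw
    | smul c v _ hv => rw [LinearMap.map_smulₛₗ]; exact S.smul_mem _ hv
  have hsurj : ∀ s ∈ S, ∃ s' ∈ S, φ s' = s := by
    intro s hs
    induction hs using Submodule.span_induction with
    | mem v hv => exact ⟨v, Submodule.subset_span hv, hv⟩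
    | zero => exact ⟨0, S.zero_mem, map_zero φ⟩
    | add v w _ _ hv hw =>
      obtain ⟨v', hv', rfl⟩ := hv
      obtain ⟨w', hw', rfl⟩ := hw
      exact ⟨v' + w', S.add_mem hv' hw', map_add φ _ _⟩
    | smul c v _ hv =>
      obtain ⟨v', hv', rfl⟩ := hv
      obtain ⟨d, rfl⟩ := exists_pow_eq hQ c
      exact ⟨d • v', S.smul_mem _ hv', by rw [LinearMap.map_smulₛₗ, hτ]⟩
  -- Artin–Schreier: φ - 1 maps S onto S. As φ - 1 is not linear, the scalar c is carried along so
  -- that the induction passes through multiples.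
  have hshift : ∀ s ∈ S, ∀ c : k, ∃ s' ∈ S, φ s' - s' = c • s := by
    intro s hs
    induction hs using Submodule.span_induction with
    | mem v hv =>
      intro c
      obtain ⟨x, hx⟩ := exists_pow_sub_self_eq hQ c
      refine ⟨x • v, S.smul_mem _ (Submodule.subset_span hv), ?_⟩
      rw [LinearMap.map_smulₛₗ, hτ, show φ v = v from hv, ← sub_smul, hx]
    | zero => exact fun c => ⟨0, S.zero_mem, by simp⟩
    | add v w _ _ hv hw =>
      intro c
      obtain ⟨v', hv', hv''⟩ := hv c
      obtain ⟨w', hw', hw''⟩ := hw c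
      refine ⟨v' + w', S.add_mem hv' hw', ?_⟩
      rw [map_add, smul_add, ← hv'', ← hw'']
      abel
    | smul d v _ hv =>
      intro c
      rw [smul_smul]
      exact hv (c * d)
  by_contra hne
  have : Nontrivial (V ⧸ S) := Submodule.Quotient.nontrivial_iff.mpr hne
  let ψ : (V ⧸ S) →ₛₗ[τ] (V ⧸ S) := S.mapQ S φ hstable
  have hψ : Function.Injective ψ := by
    rw [injective_iff_map_eq_zero]
    intro w hw
    obtain ⟨v, rfl⟩ := S.mkQ_surjective w
    have : φ v ∈ S := by
      simpa [ψ] using hw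
    obtain ⟨s, hs, hsv⟩ := hsurj _ this
    simpa [← hφ hsv] using hs
  obtain ⟨w, hw0, hw⟩ := exists_fixed_ne_zero hQ hτ ψ hψ
  obtain ⟨v, rfl⟩ := S.mkQ_surjective w
  have hv : φ v - v ∈ S := by
    rw [← Submodule.Quotient.mk_eq_zero, Submodule.Quotient.mk_sub, sub_eq_zero]
    simpa [ψ] using hw
  obtain ⟨s, hs, hsv⟩ := hshift _ hv 1
  -- Correcting v by s lifts the fixed vector of the quotient to a fixed vector of V, which lies in
  -- S by definition.
  have hfix : φ (v - s) = v - s := by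
    rw [map_sub, sub_eq_sub_iff_sub_eq_sub]
    rw [hsv, one_smul]
  apply hw0
  have : v ∈ S := by
    have := S.add_mem (Submodule.subset_span hfix : v - s ∈ S) hs
    simpa using this
  simpa using this

end FixedVectors

/-! ### Hermitian vectors and orthonormal families -/

section Hermitian

open Module

variable {k : Type*} [Field k] {V : Type*} [AddCommGroup V] [Module k V] {σ : k →+* k}

/-- The Hermitian vectors of a sesquilinear form `B`: those `v` with `B v x = σ (B x v)` for
all `x`. -/
def IsHermitianVector (B : V →ₗ[k] V →ₛₗ[σ] k) (v : V) : Prop :=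
  ∀ x, B v x = σ (B x v)

namespace IsHermitianVector

variable {B : V →ₗ[k] V →ₛₗ[σ] k} {v w : V}

theorem add (hv : IsHermitianVector B v) (hw : IsHermitianVector B w) :
    IsHermitianVector B (v + w) := fun x => by
  simp [hv x, hw x]

theorem sub (hv : IsHermitianVector B v) (hw : IsHermitianVector B w) :
    IsHermitianVector B (v - w) := fun x => by
  simp [hv x, hw x]

/-- Since σ(B(x, c v)) = σ²(c) σ(B(x, v)), only scalars fixed by σ² are allowed. -/
theorem smul {c : k} (hc : σ (σ c) = c) (hv : IsHermitianVector B v) :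
    IsHermitianVector B (c • v) := fun x => by
  simp [hv x, hc]

theorem sum {ι : Type*} {s : Finset ι} {f : ι → V} (hf : ∀ i ∈ s, IsHermitianVector B (f i)) :
    IsHermitianVector B (∑ i ∈ s, f i) := fun x => by
  simp only [map_sum, LinearMap.sum_apply]
  exact Finset.sum_congr rfl fun i hi => hf i hi x

/-- This makes Gram–Schmidt coefficients admissible scalars for Hermitian vectors. -/
theorem apply_apply (hv : IsHermitianVector B v) (hw : IsHermitianVector B w) :
    σ (σ (B v w)) = B v w := by
  rw [← hw v, ← hv w]

end IsHermitianVector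

/-- A scalar fixed by the square of the `q`-Frobenius, but not by the `q`-Frobenius itself. -/
theorem exists_pow_ne_self [IsAlgClosed k] {q : ℕ} (hq : 2 ≤ q) (hqk : (q : k) = 0)
    (hσ : ∀ x, σ x = x ^ q) : ∃ c : k, σ (σ c) = c ∧ σ c ≠ c := by
  obtain ⟨μ, hμ⟩ : ∃ μ : k, ∑ i ∈ Finset.range (q + 1), μ ^ i = 0 := by
    have hdeg : (∑ i ∈ Finset.range (q + 1), (Polynomial.X : Polynomial k) ^ i).degree ≠ 0 := by
      have h' : (∑ i ∈ Finset.range (q + 1), (Polynomial.X : Polynomial k) ^ i).coeff q = 1 := by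
        simp [Polynomial.coeff_X_pow]
      have := Polynomial.le_degree_of_ne_zero (n := q) (h'.trans_ne one_ne_zero)
      intro h0
      rw [h0] at this
      norm_cast at this
      omega
    obtain ⟨μ, hμ⟩ := IsAlgClosed.exists_root _ hdeg
    exact ⟨μ, by simpa [Polynomial.IsRoot, Polynomial.eval_finsetSum] using hμ⟩
  have hμ1 : μ ≠ 1 := by
    rintro rfl
    simp [hqk] at hμ
  have hμq : μ ^ (q + 1) = 1 := by
    have := geom_sum_mul μ (q + 1)
    rw [hμ, zero_mul] at this
    exact (sub_eq_zero.mp this.symm)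
  -- From c ^ (q - 1) = μ one gets σ c = μ c and σ (σ c) = μ ^ (q + 1) c = c.
  obtain ⟨c, hc⟩ := IsAlgClosed.exists_pow_nat_eq μ (n := q - 1) (by omega)
  have hcq : c ^ q = μ * c := by
    rw [← hc, ← pow_succ]
    congr 1
    omega
  have hμ0 : μ ≠ 0 := by
    rintro rfl
    simp at hμq
  have hc0 : c ≠ 0 := by
    rintro rfl
    rw [zero_pow (by omega)] at hc
    exact hμ0 hc.symm
  refine ⟨c, ?_, ?_⟩
  · rw [hσ, hσ, hcq, mul_pow, hcq, ← mul_assoc, ← pow_succ, hμq, one_mul]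
  · rw [hσ, hcq]
    intro h
    exact hμ1 (mul_right_cancel₀ hc0 (h.trans (one_mul c).symm))

variable [IsAlgClosed k] [FiniteDimensional k V] {q : ℕ}

/-- The Hermitian vectors of a nondegenerate form span the space. -/
theorem span_hermitianVector_eq_top (hq : 2 ≤ q) (hσ : ∀ x, σ x = x ^ q)
    (B : V →ₗ[k] V →ₛₗ[σ] k) (hB : ∀ x, (∀ y, B x y = 0) → x = 0) :
    Submodule.span k {v | IsHermitianVector B v} = ⊤ := by
  classical
  let b := Module.finBasis k V
  let A : Matrix (Fin (finrank k V)) (Fin (finrank k V)) k := Matrix.of fun i j => B (b i) (b j)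
  have hleft : ∀ x y, B x y = ∑ i, b.equivFun x i * B (b i) y := by
    intro x y
    conv_lhs => rw [← b.sum_equivFun x]
    simp only [map_sum, LinearMap.sum_apply, map_smul, LinearMap.smul_apply, smul_eq_mul]
  have hright : ∀ x y, B x y = ∑ j, B x (b j) * σ (b.equivFun y j) := by
    intro x y
    conv_lhs => rw [← b.sum_equivFun y]
    simp only [map_sum, LinearMap.map_smulₛₗ, smul_eq_mul, mul_comm]
  have hBA : ∀ x j, B x (b j) = Matrix.vecMul (b.equivFun x) A j := fun x j => hleft x (b j)
  have hA : IsUnit A.det := by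
    rw [isUnit_iff_ne_zero]
    intro h0
    obtain ⟨v, hv0, hv⟩ := Matrix.exists_vecMul_eq_zero_iff.mpr h0
    apply hv0
    have hx : b.equivFun.symm v = 0 := by
      apply hB
      intro y
      rw [hright]
      refine Finset.sum_eq_zero fun j _ => ?_
      rw [hBA, LinearEquiv.apply_symm_apply, hv, Pi.zero_apply, zero_mul]
    exact (LinearEquiv.map_eq_zero_iff _).mp hx
  let τ : k →+* k := σ.comp σ
  let f : V →ₛₗ[τ] (Fin (finrank k V) → k) :=
    { toFun := fun v j => σ (B (b j) v)
      map_add' := fun v w => by ext; simp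
      map_smul' := fun c v => by ext; simp [τ] }
  -- Nondegeneracy lets B(φ v, x) = σ(B(x, v)) be solved for φ v by inverting the Gram matrix; the
  -- fixed vectors of φ are Hermitian.
  let φ : V →ₛₗ[τ] V :=
    (b.equivFun.symm.toLinearMap ∘ₗ Matrix.vecMulLinear A⁻¹).comp f
  have hφB : ∀ v j, B (φ v) (b j) = σ (B (b j) v) := by
    intro v j
    have h : b.equivFun (φ v) = Matrix.vecMul (f v) A⁻¹ := b.equivFun.apply_symm_apply _
    rw [hBA, h, Matrix.vecMul_vecMul, Matrix.nonsing_inv_mul A hA, Matrix.vecMul_one]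
    rfl
  have hφ : Function.Injective φ := by
    rw [injective_iff_map_eq_zero]
    intro v hv
    have h1 : ∀ j, B (b j) v = 0 := by
      intro j
      have := hφB v j
      rw [hv] at this
      simpa using this.symm
    have h2 : A.mulVec (fun j => σ (b.equivFun v j)) = 0 := by
      ext i
      rw [Pi.zero_apply, ← h1 i, hright]
      rfl
    have h3 := Matrix.eq_zero_of_mulVec_eq_zero hA.ne_zero h2
    have h4 : b.equivFun v = 0 := by
      ext j
      exact (map_eq_zero σ).mp (congrFun h3 j)
    exact (LinearEquiv.map_eq_zero_iff _).mp h4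
  have htop := span_fixed_eq_top (Q := q * q) (by nlinarith)
    (fun x => by simp [τ, hσ, pow_mul]) φ hφ
  rw [eq_top_iff, ← htop]
  refine Submodule.span_mono fun v hv => ?_
  intro x
  have hv' : ∀ j, B v (b j) = σ (B (b j) v) := fun j => by
    rw [← hφB, show φ v = v from hv]
  rw [hright v x, hleft x v, map_sum]
  exact Finset.sum_congr rfl fun j _ => by rw [hv', map_mul, mul_comm]

/-- An orthonormal family of Hermitian vectors that is too short can be extended. -/
theorem exists_unit_hermitianVector (hq : 2 ≤ q) (hqk : (q : k) = 0) (hσ : ∀ x, σ x = x ^ q)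
    (B : V →ₗ[k] V →ₛₗ[σ] k) (hB : ∀ x, (∀ y, B x y = 0) → x = 0) {m : ℕ}
    (hm : m < finrank k V) (v : Fin m → V) (hv : ∀ i, IsHermitianVector B (v i))
    (hvv : ∀ i j, B (v i) (v j) = if i = j then 1 else 0) :
    ∃ w, IsHermitianVector B w ∧ (∀ i, B w (v i) = 0) ∧ B w w = 1 := by
  have hspan := span_hermitianVector_eq_top hq hσ B hB
  suffices h : ∃ w, IsHermitianVector B w ∧ (∀ i, B w (v i) = 0) ∧ B w w ≠ 0 by
    obtain ⟨w, hw, hwv, hww⟩ := h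
    -- Scaling w by c multiplies B(w, w) by c ^ (q + 1) = c σ(c). Because B(w, w) is fixed by σ, c
    -- is fixed by σ².
    obtain ⟨c, hc⟩ := IsAlgClosed.exists_pow_nat_eq (B w w)⁻¹ (n := q + 1) (by omega)
    have hb : σ (B w w) = B w w := (hw w).symm
    have hcc : c * σ c = (B w w)⁻¹ := by rw [hσ, ← hc, pow_succ']
    have hc2 : σ (σ c) = c := by
      have h1 : σ (c * σ c) = c * σ c := by rw [hcc, map_inv₀, hb]
      have hc0 : σ c ≠ 0 := right_ne_zero_of_mul (hcc.trans_ne (inv_ne_zero hww))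
      rw [map_mul, mul_comm] at h1
      exact mul_right_cancel₀ hc0 h1
    refine ⟨c • w, hw.smul hc2, fun i => by simp [hwv i], ?_⟩
    rw [LinearMap.map_smulₛₗ, map_smul, LinearMap.smul_apply, smul_eq_mul, smul_eq_mul,
      ← mul_assoc, mul_comm (σ c), hcc, inv_mul_cancel₀ hww]
  by_contra! hno
  obtain ⟨l, hl, hl'⟩ := exists_pow_ne_self hq hqk hσ
  -- Polarization: isotropy of w + w' and l • w + w' gives two equations in B(w, w') and B(w', w),
  -- independent because σ l ≠ l.
  have hiso : ∀ w w', IsHermitianVector B w → (∀ i, B w (v i) = 0) → IsHermitianVector B w' →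
      (∀ i, B w' (v i) = 0) → B w w' = 0 := by
    intro w w' hw hwv hw' hwv'
    have h1 := hno (w + w') (hw.add hw') fun i => by simp [hwv, hwv']
    have h2 := hno (l • w + w') ((hw.smul hl).add hw') fun i => by simp [hwv, hwv']
    have h3 := hno w hw hwv
    have h4 := hno w' hw' hwv'
    simp [h3, h4] at h1 h2
    have h5 : (σ l - l) * B w w' = 0 := by linear_combination σ l * h1 - h2
    exact (mul_eq_zero.mp h5).resolve_left (sub_ne_zero.mpr hl')
  have hproj : ∀ h, IsHermitianVector B h →
      IsHermitianVector B (h - ∑ i, B h (v i) • v i) ∧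
      ∀ j, B (h - ∑ i, B h (v i) • v i) (v j) = 0 := by
    intro h hh
    refine ⟨hh.sub (.sum fun i _ => (hv i).smul (hh.apply_apply (hv i))), fun j => ?_⟩
    simp [hvv]
  have hmem : ∀ h, IsHermitianVector B h → h ∈ Submodule.span k (Set.range v) := by
    intro h hh
    obtain ⟨hp, hpv⟩ := hproj h hh
    set h' := h - ∑ i, B h (v i) • v i with hh'
    -- h' is orthogonal to every v i and to the projection of every Hermitian vector, hence to all
    -- of V since Hermitian vectors span.
    have h0 : h' = 0 := by
      refine hB _ fun y => ?_
      have hy : y ∈ Submodule.span k {v | IsHermitianVector B v} := hspan ▸ Submodule.mem_top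
      induction hy using Submodule.span_induction with
      | mem g hg =>
        obtain ⟨gp, gpv⟩ := hproj g hg
        have h1 := hiso _ _ hp hpv gp gpv
        simpa [hpv] using h1
      | zero => simp
      | add x y _ _ hx hy => simp [hx, hy]
      | smul c x _ hx => simp [hx]
    rw [sub_eq_zero.mp h0]
    exact Submodule.sum_mem _ fun i _ => Submodule.smul_mem _ _ (Submodule.subset_span ⟨i, rfl⟩)
  have htop : Submodule.span k (Set.range v) = ⊤ := by
    rw [eq_top_iff, ← hspan]
    exact Submodule.span_le.mpr hmem
  have := finrank_range_le_card (R := k) v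
  rw [Set.finrank, htop, finrank_top, Fintype.card_fin] at this
  omega

/-- A nondegenerate Frobenius-sesquilinear form over an algebraically closed field admits
orthonormal families of every length up to the dimension. -/
theorem exists_orthonormal_family (hq : 2 ≤ q) (hqk : (q : k) = 0) (hσ : ∀ x, σ x = x ^ q)
    (B : V →ₗ[k] V →ₛₗ[σ] k) (hB : ∀ x, (∀ y, B x y = 0) → x = 0) {m : ℕ}
    (hm : m ≤ finrank k V) :
    ∃ v : Fin m → V, (∀ i, IsHermitianVector B (v i)) ∧
      ∀ i j, B (v i) (v j) = if i = j then 1 else 0 := by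
  induction m with
  | zero => exact ⟨Fin.elim0, fun i => i.elim0, fun i => i.elim0⟩
  | succ m ih =>
    obtain ⟨v, hv, hvv⟩ := ih (by omega)
    obtain ⟨w, hw, hwv, hww⟩ := exists_unit_hermitianVector hq hqk hσ B hB (by omega) v hv hvv
    have hvw : ∀ i, B (v i) w = 0 := fun i => by rw [hv i w, hwv, map_zero]
    refine ⟨Fin.cons w v, Fin.cases (by simpa using hw) (by simpa using hv), ?_⟩
    intro i j
    cases i using Fin.cases <;> cases j using Fin.cases <;>
      simp [hww, hwv, hvw, hvv, Fin.succ_ne_zero, (Fin.succ_ne_zero _).symm]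

end Hermitian

/-! ### Normal form when the two kernels pair nontrivially -/

section NormalForm

open Module Matrix

variable {k : Type*} [Field k] {σ : k →+* k}

/-- If the left kernel of `B` is spanned by `l`, if `r` lies in the right kernel and `B r l = 1`,
then the form is represented by `W` in a suitable linearly independent family. -/
theorem exists_family_eq_W [IsAlgClosed k] {V : Type*} [AddCommGroup V] [Module k V]
    [FiniteDimensional k V] {q : ℕ} (hq : 2 ≤ q) (hqk : (q : k) = 0) (hσ : ∀ x, σ x = x ^ q)
    (B : V →ₗ[k] V →ₛₗ[σ] k) {m : ℕ} (hV : finrank k V = m + 2) (l r : V)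
    (hl : ∀ y, B l y = 0) (hr : ∀ x, B x r = 0) (hrl : B r l = 1)
    (hker : ∀ x, (∀ y, B x y = 0) → ∃ a : k, a • l = x) :
    ∃ w : Fin (m + 2) → V, LinearIndependent k w ∧ ∀ i j, B (w i) (w j) = W k (m + 1) m i j := by
  let U : Submodule k V :=
    LinearMap.ker (B.flip l) ⊓ LinearMap.ker (B r)
  have hU : ∀ x, x ∈ U ↔ B x l = 0 ∧ B r x = 0 := fun x => by simp [U]
  have hdec : ∀ x : V, ∃ u ∈ U, ∃ a b : k, x = u + (a • l + b • r) := by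
    intro x
    -- B(r, a • l) = σ(a), so the coefficient of l is a q-th root.
    obtain ⟨a, ha⟩ := exists_pow_eq hq (B r x)
    have ha' : σ a = B r x := by rw [hσ, ha]
    refine ⟨x - (a • l + B x l • r), ?_, a, B x l, by simp⟩
    rw [hU]
    simp [hl, hr, hrl, ha']
  have hfin : m ≤ finrank k U := by
    have htop : U ⊔ Submodule.span k {l, r} = ⊤ := by
      rw [eq_top_iff]
      intro x _
      obtain ⟨u, hu, a, b, rfl⟩ := hdec x
      exact Submodule.add_mem_sup hu (Submodule.mem_span_pair.mpr ⟨a, b, rfl⟩)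
    have h1 := Submodule.finrank_add_le_finrank_add_finrank U (Submodule.span k {l, r})
    rw [htop, finrank_top, hV] at h1
    have h2 : finrank k (Submodule.span k {l, r}) ≤ 2 := by
      classical
      have := finrank_span_finset_le_card (R := k) ({l, r} : Finset V)
      rw [Set.finrank, Finset.coe_pair] at this
      exact this.trans Finset.card_le_two
    omega
  let BU : U →ₗ[k] U →ₛₗ[σ] k :=
    { toFun := fun u => (B u).comp U.subtype
      map_add' := fun u v => by ext; simp
      map_smul' := fun c u => by ext; simp }
  have hBU : ∀ u v : U, BU u v = B u v := fun u v => rfl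
  have hnd : ∀ x : U, (∀ y : U, BU x y = 0) → x = 0 := by
    intro x hx
    have hxl := ((hU x).mp x.2).1
    -- A vector of U orthogonal to U is orthogonal to l by definition of U and to r because r is in
    -- the right kernel; so it lies in ⟨l⟩, and B(r, x) = 0 kills it.
    obtain ⟨a, ha⟩ := hker x fun y => by
      obtain ⟨u, hu, a, b, rfl⟩ := hdec y
      have := hx ⟨u, hu⟩
      rw [hBU] at this
      simp [this, hxl, hr]
    have h0 : B r x = 0 := ((hU x).mp x.2).2
    rw [← ha, LinearMap.map_smulₛₗ, hrl, smul_eq_mul, mul_one] at h0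
    rw [(map_eq_zero σ).mp h0, zero_smul] at ha
    exact Subtype.ext ha.symm
  obtain ⟨v, -, hv⟩ := exists_orthonormal_family hq hqk hσ BU hnd hfin
  have hvv : ∀ i j, B (v i) (v j) = if i = j then 1 else 0 := hv
  have hvl : ∀ i, B (v i) l = 0 := fun i => ((hU _).mp (v i).2).1
  have hrv : ∀ i, B r (v i) = 0 := fun i => ((hU _).mp (v i).2).2
  let w : Fin (m + 2) → V := Fin.snoc (Fin.snoc (fun i => (v i : V)) l : Fin (m + 1) → V) r
  have hwv : ∀ i : Fin m, w i.castSucc.castSucc = v i := fun i => by simp [w]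
  have hwl : w (Fin.last m).castSucc = l := by simp [w]
  have hwr : w (Fin.last (m + 1)) = r := by simp [w]
  refine ⟨w, ?_, ?_⟩
  · rw [Fintype.linearIndependent_iff]
    intro g hg
    rw [Fin.sum_univ_castSucc, Fin.sum_univ_castSucc] at hg
    simp only [hwv, hwl, hwr] at hg
    have h1 : ∀ j : Fin m, g j.castSucc.castSucc = 0 := by
      intro j
      have := congrArg (fun x => B x (v j)) hg
      simpa [hvv, hl, hrv] using this
    have h2 : g (Fin.last (m + 1)) = 0 := by
      have := congrArg (fun x => B x l) hg
      simpa [hvl, hl, hrl] using this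
    have h3 : g (Fin.last m).castSucc = 0 := by
      have hl0 : l ≠ 0 := by
        rintro rfl
        simp at hrl
      simp only [h1, h2, zero_smul, Finset.sum_const_zero, zero_add, add_zero] at hg
      exact (smul_eq_zero.mp hg).resolve_right hl0
    exact Fin.lastCases h2 (Fin.lastCases h3 h1)
  · intro i j
    refine Fin.lastCases ?_ (Fin.lastCases ?_ fun i => ?_) i <;>
    refine Fin.lastCases ?_ (Fin.lastCases ?_ fun j => ?_) j <;>
    simp only [hwv, hwl, hwr, hl, hr, hrl, hvl, hrv, hvv, W, Matrix.of_apply, Fin.val_last,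
      Fin.val_castSucc, Fin.ext_iff]
    · simp
    · simp
    · have := j.isLt
      rw [if_neg (by omega)]
    · rw [if_neg (by omega)]
    · rw [if_neg (by omega)]
    · have := j.isLt
      rw [if_neg (by omega)]
    · have := i.isLt
      rw [if_neg (by omega)]
    · have := i.isLt
      rw [if_neg (by omega)]
    · have := i.isLt
      have := j.isLt
      congr 1
      simp only [eq_iff_iff]
      omega

/-- The sesquilinear form `(x, y) ↦ ∑ a_ij x_i σ(y_j)` of a matrix. -/
noncomputable def sesqForm {N : ℕ} (σ : k →+* k) (A : Matrix (Fin N) (Fin N) k) :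
    (Fin N → k) →ₗ[k] (Fin N → k) →ₛₗ[σ] k :=
  Matrix.toLinearMapₛₗ₂' k (RingHom.id k) σ A

theorem sesqForm_apply {N : ℕ} (A : Matrix (Fin N) (Fin N) k) (x y : Fin N → k) :
    sesqForm σ A x y = ∑ i, ∑ j, x i * A i j * σ (y j) := by
  rw [sesqForm, Matrix.toLinearMapₛₗ₂'_apply]
  refine Finset.sum_congr rfl fun i _ => Finset.sum_congr rfl fun j _ => ?_
  simp only [smul_eq_mul, RingHom.id_apply]
  ring

theorem sesqForm_eq_dotProduct_mulVec {N : ℕ} (A : Matrix (Fin N) (Fin N) k) (x y : Fin N → k) :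
    sesqForm σ A x y = x ⬝ᵥ A *ᵥ (fun j => σ (y j)) := by
  simp only [sesqForm_apply, dotProduct, mulVec, Finset.mul_sum, mul_assoc]

theorem sesqForm_eq_vecMul_dotProduct {N : ℕ} (A : Matrix (Fin N) (Fin N) k) (x y : Fin N → k) :
    sesqForm σ A x y = x ᵥ* A ⬝ᵥ (fun j => σ (y j)) := by
  rw [sesqForm_eq_dotProduct_mulVec, dotProduct_mulVec]

theorem equivalent_of_sesqForm {N q : ℕ} (hσ : ∀ x, σ x = x ^ q) {A A' : Matrix (Fin N) (Fin N) k}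
    (w : Fin N → Fin N → k) (hw : LinearIndependent k w)
    (h : ∀ i j, sesqForm σ A (w i) (w j) = A' i j) : Equivalent q A A' := by
  have hT : IsUnit (Matrix.of w)ᵀ :=
    Matrix.linearIndependent_cols_iff_isUnit.mp hw
  refine ⟨hT.unit, ?_⟩
  ext i j
  rw [IsUnit.unit_spec, ← h, Matrix.mul_assoc, Matrix.mul_apply, sesqForm_eq_dotProduct_mulVec]
  simp only [dotProduct, mulVec, Matrix.mul_apply, frobeniusTwist, hσ, Matrix.transpose_apply,
    Matrix.of_apply, Matrix.map_apply]

/-- The polynomials in the entries of `A` which, for `A` of corank one, express that the form does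
not vanish on the right and left kernels. -/
noncomputable def kernelPairing {R : Type*} [CommRing R] {N : ℕ} (q : ℕ)
    (A : Matrix (Fin N) (Fin N) R) (i j : Fin N) : R :=
  ∑ a, ∑ b, A.adjugate a i * A a b ^ q * A.adjugate j b ^ (q * q)

/-- As det A = 0, rows of the adjugate lie in the left kernel and columns in the kernel of A. The
second variable of the form is Frobenius-twisted, so r consists of q-th roots of a column. -/
theorem equivalent_W_of_kernelPairing_ne_zero [IsAlgClosed k] {q : ℕ} (hq : 2 ≤ q)
    (hqk : (q : k) = 0) (hσ : ∀ x, σ x = x ^ q) {m : ℕ}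
    (A : Matrix (Fin (m + 2)) (Fin (m + 2)) k) (hA : A.rank = m + 1) (i j : Fin (m + 2))
    (h : kernelPairing q A i j ≠ 0) : Equivalent q A (W k (m + 1) m) := by
  have hdet : A.det = 0 := by
    by_contra h0
    have := Matrix.rank_of_isUnit A ((Matrix.isUnit_iff_isUnit_det A).mpr (isUnit_iff_ne_zero.mpr h0))
    rw [hA, Fintype.card_fin] at this
    omega
  let l : Fin (m + 2) → k := fun b => A.adjugate j b
  choose r hr using fun a => exists_pow_eq hq (A.adjugate a i)
  have hlA : l ᵥ* A = 0 := by
    have := congrFun (A.adjugate_mul) j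
    rw [hdet, zero_smul] at this
    exact this
  have hAr : A *ᵥ (fun a => σ (r a)) = 0 := by
    ext b
    have := congrFun (congrFun A.mul_adjugate b) i
    rw [hdet, zero_smul] at this
    simp only [hσ, hr]
    exact this.trans (Matrix.zero_apply _ _)
  have hc : sesqForm σ A r l ≠ 0 := by
    intro h0
    apply h
    rw [sesqForm_apply] at h0
    -- Applying σ removes the q-th roots: σ(B(r, l)) is `kernelPairing`, which explains its
    -- exponents q and q².
    have := congrArg σ h0
    simp only [map_sum, map_mul, map_zero] at this
    rw [← this, kernelPairing]
    refine Finset.sum_congr rfl fun a _ => Finset.sum_congr rfl fun b _ => ?_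
    simp only [hσ, hr, l, pow_mul]
  have hl0 : l ≠ 0 := by
    intro h0
    simp [h0] at hc
  have hker : ∀ x, (∀ y, sesqForm σ A x y = 0) → ∃ a : k, a • l = x := by
    intro x hx
    have hxA : x ᵥ* A = 0 := by
      ext b
      have := hx (Pi.single b 1)
      rw [sesqForm_eq_vecMul_dotProduct] at this
      simpa [dotProduct, Pi.single_apply, apply_ite σ] using this
    have hfin : finrank k (LinearMap.ker A.vecMulLinear) = 1 := by
      have h1 := LinearMap.finrank_range_add_finrank_ker A.vecMulLinear
      have h2 : finrank k (LinearMap.range A.vecMulLinear) = m + 1 := by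
        rw [← hA, ← Matrix.rank_transpose, Matrix.rank, Matrix.mulVecLin_transpose]
      rw [h2, finrank_fin_fun] at h1
      omega
    obtain ⟨a, ha⟩ := (finrank_eq_one_iff_of_nonzero' (⟨l, hlA⟩ : LinearMap.ker A.vecMulLinear)
      (fun h0 => hl0 (congrArg Subtype.val h0))).mp hfin ⟨x, hxA⟩
    exact ⟨a, congrArg Subtype.val ha⟩
  obtain ⟨w, hw, hw'⟩ := exists_family_eq_W hq hqk hσ (sesqForm σ A) (finrank_fin_fun k) l
    ((sesqForm σ A r l)⁻¹ • r)
    (fun y => by rw [sesqForm_eq_vecMul_dotProduct, hlA, zero_dotProduct])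
    (fun x => by
      rw [LinearMap.map_smulₛₗ, sesqForm_eq_dotProduct_mulVec A x r, hAr, dotProduct_zero,
        smul_zero])
    (by rw [map_smul, LinearMap.smul_apply, smul_eq_mul, inv_mul_cancel₀ hc]) hker
  exact equivalent_of_sesqForm hσ w hw hw'

end NormalForm

/-! ### From equivalent matrices to projectively isomorphic hypersurfaces -/

section Projective

variable {k : Type*} [Field k] {N q : ℕ}

open Matrix

theorem eval_changeCoordinates (T : Matrix (Fin N) (Fin N) k) (v : Fin N → k)
    (F : MvPolynomial (Fin N) k) :
    MvPolynomial.eval v (changeCoordinates T F) = MvPolynomial.eval (T.mulVec v) F := by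
  induction F using MvPolynomial.induction_on with
  | C a => simp [changeCoordinates]
  | add p q hp hq => simp [hp, hq]
  | mul_X p i hp =>
    rw [map_mul, map_mul, map_mul, hp]
    simp [changeCoordinates, Matrix.mulVec, dotProduct]

theorem eval_form {σ : k →+* k} (hσ : ∀ x, σ x = x ^ q) (A : Matrix (Fin N) (Fin N) k)
    (v : Fin N → k) : MvPolynomial.eval v (form q A) = sesqForm σ A v v := by
  simp [form, sesqForm_apply, hσ, mul_comm]

/-- The change of coordinates `T` carries the form of `A` to that of `ᵗT A T^(q)`. -/
theorem changeCoordinates_form [Infinite k] {σ : k →+* k} (hσ : ∀ x, σ x = x ^ q)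
    (A T : Matrix (Fin N) (Fin N) k) :
    changeCoordinates T (form q A) = form q (Tᵀ * A * frobeniusTwist q T) := by
  refine MvPolynomial.funext fun v => ?_
  have hT : frobeniusTwist q T *ᵥ (fun j => σ (v j)) = fun j => σ ((T *ᵥ v) j) := by
    ext j
    simp [mulVec, dotProduct, frobeniusTwist, ← hσ]
  rw [eval_changeCoordinates, eval_form hσ, eval_form hσ, sesqForm_eq_dotProduct_mulVec,
    sesqForm_eq_dotProduct_mulVec, ← mulVec_mulVec, ← mulVec_mulVec, hT, dotProduct_mulVec v,
    vecMul_transpose]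

open scoped Pointwise in
theorem projectivelyIsomorphic_of_changeCoordinates {F G : MvPolynomial (Fin N) k}
    (T : GL (Fin N) k) (h : changeCoordinates (T : Matrix (Fin N) (Fin N) k) F = G) :
    ProjectivelyIsomorphic F G := by
  refine ⟨T, by rw [Ideal.map_span, Set.image_singleton, h], ?_⟩
  have key : ∀ P, Matrix.GeneralLinearGroup.toLin T • P ∈ hypersurface F ↔ P ∈ hypersurface G := by
    intro P
    induction P using Projectivization.ind with
    | h v hv =>
      have hT : Matrix.GeneralLinearGroup.toLin T • v = (T : Matrix (Fin N) (Fin N) k) *ᵥ v := rfl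
      rw [Projectivization.smul_mk, hypersurface, hypersurface, Set.mem_ofPred_eq, Set.mem_ofPred_eq,
        Projectivization.submodule_mk, Projectivization.submodule_mk]
      simp only [Submodule.mem_span_singleton, forall_exists_index, forall_apply_eq_imp_iff, ← h,
        eval_changeCoordinates, hT, mulVec_smul]
  ext P
  rw [Set.mem_smul_set_iff_inv_smul_mem, ← key, smul_inv_smul]

end Projective

/-! ### Irreducibility of the set of matrices of given rank -/

section ZariskiDensity

open Matrix

variable {k : Type*} [Field k]

theorem isTopologicalBasis_zariskiTopology (N : ℕ) :
    @TopologicalSpace.IsTopologicalBasis _ (zariskiTopology k N)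
      (Set.range fun f : MvPolynomial (Fin N × Fin N) k =>
        {A : Matrix (Fin N) (Fin N) k | MvPolynomial.eval (fun ij => A ij.1 ij.2) f ≠ 0}) := by
  let := zariskiTopology k N
  refine ⟨?_, ?_, rfl⟩
  · rintro _ ⟨f, rfl⟩ _ ⟨g, rfl⟩ A ⟨hf, hg⟩
    refine ⟨_, ⟨f * g, rfl⟩, ?_, fun B hB => ?_⟩
    · show MvPolynomial.eval _ (f * g) ≠ 0
      rw [map_mul]
      exact mul_ne_zero hf hg
    · have hB' : MvPolynomial.eval (fun ij => B ij.1 ij.2) (f * g) ≠ 0 := hB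
      rw [map_mul] at hB'
      exact ⟨left_ne_zero_of_mul hB', right_ne_zero_of_mul hB'⟩
  · refine Set.eq_univ_of_forall fun A => ⟨_, ⟨1, rfl⟩, ?_⟩
    show MvPolynomial.eval _ 1 ≠ 0
    simp

/-- The rank is a free variable r so that two matrices of equal rank get normal forms over the same
block type. -/
theorem exists_rank_normal_form_of_rank_eq {ι : Type*} [Fintype ι] [DecidableEq ι]
    (M : Matrix ι ι k) {r : ℕ} (hM : M.rank = r) :
    ∃ (P Q : Matrix ι ι k) (e : ι ≃ Fin r ⊕ Fin (Fintype.card ι - r)), IsUnit P ∧ IsUnit Q ∧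
      P * M * Q = (fromBlocks 1 0 0 0).submatrix e e := by
  subst hM
  exact M.exists_rank_normal_form

/-- Square matrices of the same rank are equivalent. -/
theorem exists_mul_mul_eq_of_rank_eq {ι : Type*} [Fintype ι] [DecidableEq ι]
    {A B : Matrix ι ι k} (h : A.rank = B.rank) :
    ∃ P Q : Matrix ι ι k, IsUnit P ∧ IsUnit Q ∧ P * A * Q = B := by
  obtain ⟨P, Q, e, hP, hQ, hA⟩ := exists_rank_normal_form_of_rank_eq A h
  obtain ⟨P', Q', e', hP', hQ', hB⟩ := exists_rank_normal_form_of_rank_eq B rfl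
  -- The two normal forms differ by this relabelling, which is absorbed into P' and Q'.
  let ε : ι ≃ ι := e.trans e'.symm
  have h1 : P * A * Q = P'.submatrix ε (Equiv.refl ι) * B * Q'.submatrix (Equiv.refl ι) ε := by
    have h2 : (P' * B * Q').submatrix ε ε = P * A * Q := by
      rw [hA, hB, submatrix_submatrix]
      congr 1 <;> ext <;> simp [ε]
    rw [← h2, ← submatrix_mul_equiv _ _ ε (Equiv.refl ι) ε,
      ← submatrix_mul_equiv _ _ ε (Equiv.refl ι) (Equiv.refl ι)]
    rfl
  have hP2 : IsUnit (P'.submatrix ε (Equiv.refl ι)) := (isUnit_submatrix_equiv _ _).mpr hP'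
  have hQ2 : IsUnit (Q'.submatrix (Equiv.refl ι) ε) := (isUnit_submatrix_equiv _ _).mpr hQ'
  obtain ⟨u, hu⟩ := hP2
  obtain ⟨w, hw⟩ := hQ2
  rw [← hu, ← hw] at h1
  refine ⟨(↑u⁻¹ : Matrix ι ι k) * P, Q * (↑w⁻¹ : Matrix ι ι k), u⁻¹.isUnit.mul hP,
    hQ.mul w⁻¹.isUnit, ?_⟩
  calc (↑u⁻¹ : Matrix ι ι k) * P * A * (Q * ↑w⁻¹) = ↑u⁻¹ * (P * A * Q) * ↑w⁻¹ := by
        simp only [mul_assoc]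
    _ = B := by
        rw [h1]
        simp [mul_assoc]

/-- The matrices of a given rank form an irreducible set: two nonempty principal open subsets of it
meet. -/
theorem exists_rank_eq_eval_ne_zero [Infinite k] {N : ℕ} {A B : Matrix (Fin N) (Fin N) k}
    (h : A.rank = B.rank) {f g : MvPolynomial (Fin N × Fin N) k}
    (hf : MvPolynomial.eval (fun ij => A ij.1 ij.2) f ≠ 0)
    (hg : MvPolynomial.eval (fun ij => B ij.1 ij.2) g ≠ 0) :
    ∃ C : Matrix (Fin N) (Fin N) k, C.rank = A.rank ∧
      MvPolynomial.eval (fun ij => C ij.1 ij.2) f ≠ 0 ∧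
      MvPolynomial.eval (fun ij => C ij.1 ij.2) g ≠ 0 := by
  obtain ⟨P, Q, hP, hQ, rfl⟩ := exists_mul_mul_eq_of_rank_eq h
  -- Segments from 1 at t = 0 to P and Q at t = 1 give a polynomial curve from A to P A Q, of
  -- constant rank wherever both determinants are nonzero. Four nonzero polynomials in t have a
  -- common nonroot.
  open Polynomial in
  let seg : Matrix (Fin N) (Fin N) k → Matrix (Fin N) (Fin N) k[X] := fun M =>
    1 + (X : k[X]) • (M - 1).map C
  let curve : Matrix (Fin N) (Fin N) (Polynomial k) := seg P * A.map Polynomial.C * seg Q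
  let ev : k → Matrix (Fin N) (Fin N) (Polynomial k) →+* Matrix (Fin N) (Fin N) k :=
    fun t => (Polynomial.evalRingHom t).mapMatrix
  have hseg : ∀ t M, ev t (seg M) = 1 + t • (M - 1) := by
    intro t M
    ext i j
    by_cases hij : i = j <;> simp [ev, seg, hij, mul_comm t]
  have hC : ∀ t, ev t (A.map Polynomial.C) = A := by
    intro t
    ext i j
    simp [ev]
  have hcurve : ∀ t, ev t curve = (1 + t • (P - 1)) * A * (1 + t • (Q - 1)) := by
    intro t
    rw [map_mul, map_mul, hseg, hseg, hC]
  let pull : MvPolynomial (Fin N × Fin N) k → Polynomial k :=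
    fun F => MvPolynomial.aeval (fun ij => curve ij.1 ij.2) F
  have hpull : ∀ t F, (pull F).eval t =
      MvPolynomial.eval (fun ij => (ev t curve) ij.1 ij.2) F := by
    intro t F
    induction F using MvPolynomial.induction_on with
    | C a => simp [pull]
    | add p q hp hq => simp_all [pull]
    | mul_X p i hp => simp_all [pull, ev]
  have hdet : ∀ t M, (seg M).det.eval t = (1 + t • (M - 1)).det := by
    intro t M
    rw [← hseg]
    exact RingHom.map_det (Polynomial.evalRingHom t) (seg M)
  have hne : ∀ {F : Polynomial k} (t : k), F.eval t ≠ 0 → F ≠ 0 := by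
    rintro F t ht rfl
    simp at ht
  have h1 : pull f ≠ 0 := hne 0 (by rw [hpull, hcurve]; simpa using hf)
  have h2 : pull g ≠ 0 := hne 1 (by rw [hpull, hcurve]; simpa using hg)
  have h3 : (seg P).det ≠ 0 := hne 0 (by rw [hdet]; simp)
  have h4 : (seg Q).det ≠ 0 := hne 0 (by rw [hdet]; simp)
  obtain ⟨t, ht⟩ : ∃ t, (pull f * pull g * (seg P).det * (seg Q).det).eval t ≠ 0 := by
    by_contra! h0
    exact mul_ne_zero (mul_ne_zero (mul_ne_zero h1 h2) h3) h4
      (Polynomial.funext fun t => by rw [h0, Polynomial.eval_zero])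
  simp only [Polynomial.eval_mul, hpull, hdet, mul_ne_zero_iff] at ht
  obtain ⟨⟨⟨htf, htg⟩, htP⟩, htQ⟩ := ht
  refine ⟨ev t curve, ?_, htf, htg⟩
  rw [hcurve, rank_mul_eq_left_of_det_ne_zero _ _ htQ, rank_mul_eq_right_of_det_ne_zero _ _ htP]

/-- A property implied, on the matrices of the rank of `B`, by the nonvanishing of any one of the
polynomials `g i` holds at a general matrix of that rank, if some `g i` does not vanish at `B`. -/
theorem holdsAtGeneralPoint_rank_eq [Infinite k] {N : ℕ} {ι : Type*}
    (g : ι → MvPolynomial (Fin N × Fin N) k) {B : Matrix (Fin N) (Fin N) k} {i₀ : ι}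
    (hB : MvPolynomial.eval (fun ij => B ij.1 ij.2) (g i₀) ≠ 0)
    {P : Matrix (Fin N) (Fin N) k → Prop}
    (hP : ∀ A : Matrix (Fin N) (Fin N) k, A.rank = B.rank →
      ∀ i, MvPolynomial.eval (fun ij => A ij.1 ij.2) (g i) ≠ 0 → P A) :
    HoldsAtGeneralPoint {A : Matrix (Fin N) (Fin N) k | A.rank = B.rank} P := by
  let := zariskiTopology k N
  refine ⟨⋃ i, {A | MvPolynomial.eval (fun ij => A ij.1 ij.2) (g i) ≠ 0},
    isOpen_iUnion fun i => TopologicalSpace.isOpen_generateFrom_of_mem ⟨g i, rfl⟩,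
    ⟨B, rfl, Set.mem_iUnion.mpr ⟨i₀, hB⟩⟩, ?_, ?_⟩
  · intro A hA
    rw [(isTopologicalBasis_zariskiTopology N).mem_closure_iff]
    rintro _ ⟨f, rfl⟩ hf
    obtain ⟨C, hC, hCf, hCg⟩ := exists_rank_eq_eval_ne_zero hA hf hB
    exact ⟨C, hCf, hC.trans hA, Set.mem_iUnion.mpr ⟨i₀, hCg⟩⟩
  · rintro A ⟨hA, hA'⟩
    obtain ⟨i, hi⟩ := Set.mem_iUnion.mp hA'
    exact hP A hA i hi

end ZariskiDensity

/-! ### The open condition holds at W -/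

section Witness

open Matrix

variable (k : Type*) [Field k] (m : ℕ)

theorem W_rank : (W k (m + 1) m).rank = m + 1 := by
  classical
  -- Swapping the last two columns of W leaves a diagonal matrix with a single zero.
  have h : W k (m + 1) m =
      (diagonal fun i : Fin (m + 2) => if i.val = m then (0 : k) else 1).submatrix
      (Equiv.refl _) (Equiv.swap (Fin.last m).castSucc (Fin.last (m + 1))) := by
    ext i j
    have hi := i.isLt
    have hj := j.isLt
    have hswap : (Equiv.swap (Fin.last m).castSucc (Fin.last (m + 1)) j).val =
        if j.val = m then m + 1 else if j.val = m + 1 then m else j.val := by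
      simp only [Equiv.swap_apply_def, Fin.ext_iff, Fin.val_castSucc, Fin.val_last]
      split_ifs <;> rfl
    simp only [W, of_apply, submatrix_apply, diagonal_apply, Equiv.refl_apply, Fin.ext_iff, hswap]
    clear hswap
    split_ifs <;> first | rfl | omega
  rw [h, rank_submatrix, rank_diagonal]
  have h2 : ∀ i : Fin (m + 2),
      (if i.val = m then (0 : k) else 1) ≠ 0 ↔ i ≠ (Fin.last m).castSucc := by
    intro i
    simp [Fin.ext_iff]
  rw [Fintype.card_congr (Equiv.subtypeEquivRight h2), Fintype.card_subtype_compl]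
  simp

/-- Here the left kernel is the line of e_s and the right kernel that of e_t, so only the term with
W_ts = 1 survives. -/
theorem kernelPairing_W_ne_zero {q : ℕ} (hq : q ≠ 0) :
    kernelPairing q (W k (m + 1) m) (Fin.last m).castSucc (Fin.last (m + 1)) ≠ 0 := by
  set s : Fin (m + 2) := (Fin.last m).castSucc
  set t : Fin (m + 2) := Fin.last (m + 1)
  have hs : s.val = m := rfl
  have ht : t.val = m + 1 := rfl
  have hst : s ≠ t := by
    intro h
    have := congrArg Fin.val h
    omega
  have hcol : ∀ i, W k (m + 1) m i t = 0 := by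
    intro i
    have hi := i.isLt
    rw [W, of_apply, if_neg (by omega)]
  have hrow : ∀ j, W k (m + 1) m s j = 0 := by
    intro j
    rw [W, of_apply, if_neg (by omega)]
  have hts : W k (m + 1) m t s = 1 := by
    rw [W, of_apply, if_pos (by omega)]
  have h1 : ∀ a, a ≠ t → (W k (m + 1) m).adjugate a s = 0 := by
    intro a ha
    rw [adjugate_apply]
    refine det_eq_zero_of_column_eq_zero t fun i => ?_
    rw [updateRow_apply]
    split_ifs
    · simp [ha.symm]
    · exact hcol i
  have h2 : ∀ b, b ≠ s → (W k (m + 1) m).adjugate t b = 0 := by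
    intro b hb
    rw [adjugate_apply]
    refine det_eq_zero_of_row_eq_zero s fun j => ?_
    rw [updateRow_ne hb.symm]
    exact hrow j
  have h3 : (W k (m + 1) m).adjugate t s ≠ 0 := by
    -- This cofactor is the determinant of a transposition.
    have h : (W k (m + 1) m).updateRow s (Pi.single t 1) =
        (1 : Matrix (Fin (m + 2)) (Fin (m + 2)) k).submatrix id (Equiv.swap s t) := by
      ext i j
      have hi := i.isLt
      have hj := j.isLt
      simp only [updateRow_apply, W, of_apply, submatrix_apply, one_apply, id, Pi.single_apply,
        Equiv.swap_apply_def, Fin.ext_iff, hs, ht]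
      split_ifs <;> simp_all <;> omega
    rw [adjugate_apply, h, det_permute', det_one, mul_one, Equiv.Perm.sign_swap hst]
    simp
  rw [kernelPairing, Finset.sum_eq_single t, Finset.sum_eq_single s, hts, one_pow, mul_one]
  · exact mul_ne_zero h3 (pow_ne_zero _ h3)
  · intro b _ hb
    rw [h2 b hb, zero_pow (mul_ne_zero hq hq), mul_zero]
  · simp
  · intro a _ ha
    simp [h1 a ha]
  · simp

theorem map_kernelPairing {R S : Type*} [CommRing R] [CommRing S] (φ : R →+* S) {N : ℕ} (q : ℕ)
    (A : Matrix (Fin N) (Fin N) R) (i j : Fin N) :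
    φ (kernelPairing q A i j) = kernelPairing q (φ.mapMatrix A) i j := by
  have h : ∀ a b, (A.map φ).adjugate a b = φ (A.adjugate a b) := fun a b =>
    congrFun (congrFun (φ.map_adjugate A) a) b |>.symm
  simp only [kernelPairing, h, map_sum, map_mul, map_pow, RingHom.mapMatrix_apply, map_apply]

end Witness

end DegenerateFermat

theorem corollary1p3 {k : Type*} [Field k] [IsAlgClosed k] (p : ℕ) [Fact p.Prime] [CharP k p]
    (q : ℕ) (hq : ∃ e : ℕ, 0 < e ∧ q = p ^ e) (n : ℕ) (hn : 0 < n) :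
    DegenerateFermat.HoldsAtGeneralPoint
      {A : Matrix (Fin (n + 1)) (Fin (n + 1)) k | A.rank = n}
      (fun A =>
        DegenerateFermat.Equivalent q A (DegenerateFermat.W k n (n - 1)) ∧
        DegenerateFermat.ProjectivelyIsomorphic (DegenerateFermat.form q A)
          (DegenerateFermat.form q (DegenerateFermat.W k n (n - 1)))) := by
  obtain ⟨e, he, rfl⟩ := hq
  obtain ⟨m, rfl⟩ := Nat.exists_eq_succ_of_ne_zero hn.ne'
  have hp : p.Prime := Fact.out
  have hq2 : 2 ≤ p ^ e := hp.two_le.trans (Nat.le_self_pow he.ne' p)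
  have hqk : ((p ^ e : ℕ) : k) = 0 := by
    rw [Nat.cast_pow, CharP.cast_eq_zero, zero_pow he.ne']
  have hσ : ∀ x : k, iterateFrobenius k p e x = x ^ p ^ e := iterateFrobenius_def p e
  have : Infinite k := IsAlgClosed.instInfinite
  -- Evaluating the pairing on the generic matrix turns it into polynomials in the entries.
  let g : Fin (m + 2) × Fin (m + 2) → MvPolynomial (Fin (m + 2) × Fin (m + 2)) k := fun ij =>
    DegenerateFermat.kernelPairing (p ^ e) (Matrix.mvPolynomialX _ _ k) ij.1 ij.2
  have hg : ∀ (A : Matrix (Fin (m + 2)) (Fin (m + 2)) k) ij,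
      MvPolynomial.eval (fun ij => A ij.1 ij.2) (g ij) =
        DegenerateFermat.kernelPairing (p ^ e) A ij.1 ij.2 := by
    intro A ij
    rw [DegenerateFermat.map_kernelPairing, Matrix.mvPolynomialX_mapMatrix_eval]
  have key := DegenerateFermat.holdsAtGeneralPoint_rank_eq g
    (B := DegenerateFermat.W k (m + 1) m) (i₀ := ((Fin.last m).castSucc, Fin.last (m + 1)))
    (by rw [hg]; exact DegenerateFermat.kernelPairing_W_ne_zero k m (by omega))
    (P := fun A => DegenerateFermat.Equivalent (p ^ e) A (DegenerateFermat.W k (m + 1) m) ∧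
        DegenerateFermat.ProjectivelyIsomorphic (DegenerateFermat.form (p ^ e) A)
          (DegenerateFermat.form (p ^ e) (DegenerateFermat.W k (m + 1) m)))
    (by
      intro A hA ij hij
      rw [hg] at hij
      rw [DegenerateFermat.W_rank] at hA
      obtain ⟨T, hT⟩ := DegenerateFermat.equivalent_W_of_kernelPairing_ne_zero hq2 hqk hσ A hA
        ij.1 ij.2 hij
      refine ⟨⟨T, hT⟩, ?_⟩
      refine DegenerateFermat.projectivelyIsomorphic_of_changeCoordinates T ?_
      rw [hT]
      exact DegenerateFermat.changeCoordinates_form hσ A T)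
  rw [DegenerateFermat.W_rank] at key
  exact key
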